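/- **Setting.** Let $G=(V,E)$ be a finite bipartite multigraph (parallel edges are allowed) with bipartition $V=V_P\cup V_L$, where $V_P=\{u_1,\dots,u_m\}$ and $V_L=\{v_1,\dots,v_n\}$. Let $t:V_L\to\mathbb R$ and $c:E\to\mathbb R$, and write $t_j=t(v_j)$ and $c_e=c(e)$. The triple $(G,t,c)$ is called a *point-line frame*. It is *generic* if the family of real numbers $(t_j)_{v_j\in V_L},(c_e)_{e\in E}$ is algebraically independent over $\mathbb Q$. Three real matrices with rows indexed by $E$ are associated with it. In the row of an edge $e=u_iv_j$: - the matrix $A(G,t,c)$, of size $|E|\times 2|V|$, has $(1,t_j)$ in the two columns of $u_i$, $(c_e,-1)$ in the two columns of $v_j$, and zeros elsewhere; - the matrix $B(G,c)$, of size $|E|\times(2|V_P|+|V_L|)$, has $(1,c_e)$ in the two columns of $u_i$, $-1$ in the column of $v_j$, and zeros elsewhere; - the matrix $C(G,t)$, of size $|E|\times(2|V_P|+|V_L|)$, has $(1,t_j)$ in the two columns of $u_i$, $-1$ in the column of $v_j$, and zeros elsewhere. For $S\subseteq E$ let $\nu_P(S)$ and $\nu_L(S)$ be the numbers of vertices of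 $V_P$ and of $V_L$, respectively, that are incident to an edge of $S$. For $f:2^E\to\mathbb Z$ that is nondecreasing, intersecting submodular (that is, $f(S\cup T)+f(S\cap T)\le f(S)+f(T)$ whenever $S\cap T\ne\emptyset$) and nonnegative on nonempty sets, let $\mathcal M_G(f)$ be the matroid on $E$ in which $I\subseteq E$ is independent if and only if $|J|\le f(J)$ for all $\emptyset\ne J\subseteq I$. The functions $2\nu_P+\nu_L-1$, $2\nu_P+\nu_L-2$ and $\nu_L$ have these properties. For matroids $\mathcal M_1,\mathcal M_2$ on $E$, the union $\mathcal M_1\vee\mathcal M_2$ is the matroid on $E$ whose independent sets are the sets $I_1\cup I_2$ with $I_i$ independent in $\mathcal M_i$. The *row matroid* of a real matrix with rows indexed by $E$ is the matroid on $E$ in which $I\subseteq E$ is independent if and only if the rows indexed by $I$ are linearly independent over $\mathbb R$. **Lemma.** Suppose that $(G,t,c)$ is a generic point-line frame. Then: (a) the row matroid of $B(G,c)$ is $\mathcal M_G(2\nu_P+\nu_L-1)$; (b) the row matroid of $C(G,t)$ is $\mathcal M_G(2\nu_P+\nu_L-2)$; (c) the row matroid of $A(G,t,c)$ is $\mathcal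 M_G(2\nu_P+\nu_L-2)\vee\mathcal M_G(\nu_L)$. -/

import Mathlib

/-- A bipartite multigraph with bipartition `(P, L)` and edge set `E`: every edge `e` joins the
point-vertex `pt e : P` to the line-vertex `ln e : L`. Parallel edges and isolated vertices
are allowed. -/
structure BipartiteMultigraph (P L E : Type*) where
  pt : E → P
  ln : E → L

/-! ### Matroids on a finite set: induced matroids, unions, row matroids -/

section InducedMatroid

variable {E : Type*} [DecidableEq E]

/-- `f` is nondecreasing, intersecting submodular, and nonnegative on nonempty sets. -/
structure IsMatroidInducing (f : Finset E → ℤ) : Prop where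
  mono : ∀ S T : Finset E, S ⊆ T → f S ≤ f T
  submod : ∀ S T : Finset E, (S ∩ T).Nonempty → f (S ∪ T) + f (S ∩ T) ≤ f S + f T
  nonneg : ∀ S : Finset E, S.Nonempty → 0 ≤ f S

/-- Independence in the matroid induced by `f`. -/
def InducedIndep (f : Finset E → ℤ) (I : Finset E) : Prop :=
  ∀ J : Finset E, J.Nonempty → J ⊆ I → (J.card : ℤ) ≤ f J

theorem InducedIndep.augment {f : Finset E → ℤ} (hf : IsMatroidInducing f) {I J : Finset E}
    (hI : InducedIndep f I) (hJ : InducedIndep f J) (hlt : I.card < J.card) :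
    ∃ e ∈ J, e ∉ I ∧ InducedIndep f (insert e I) := by
  classical
  by_contra! hcon
  -- `T` is tight when `f T ≤ |T ∩ I|`
  have tight_union : ∀ S T : Finset E, (S ∩ T).Nonempty → f S ≤ ((S ∩ I).card : ℤ) →
      f T ≤ ((T ∩ I).card : ℤ) → f (S ∪ T) ≤ (((S ∪ T) ∩ I).card : ℤ) := by
    intro S T hST hS hT
    have h1 := hf.submod S T hST
    have h2 : (((S ∩ T) ∩ I).card : ℤ) ≤ f (S ∩ T) := by
      rcases ((S ∩ T) ∩ I).eq_empty_or_nonempty with h | h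
      · rw [h]; simpa using hf.nonneg _ hST
      · exact (hI _ h Finset.inter_subset_right).trans (hf.mono _ _ Finset.inter_subset_left)
    have h3 := Finset.card_union_add_card_inter (S ∩ I) (T ∩ I)
    rw [← Finset.union_inter_distrib_right, ← Finset.inter_inter_distrib_right] at h3
    zify at h3
    linarith
  have tight_exists : ∀ e ∈ J \ I, ∃ T : Finset E, e ∈ T ∧ T ⊆ insert e I ∧
      f T ≤ ((T ∩ I).card : ℤ) := by
    intro e he
    rw [Finset.mem_sdiff] at he
    have h := hcon e he.1 he.2
    unfold InducedIndep at h
    push Not at h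
    obtain ⟨T, hTn, hT, hlt'⟩ := h
    have heT : e ∈ T := by
      by_contra heT
      have : T ⊆ I := fun x hx => by
        rcases Finset.mem_insert.1 (hT hx) with rfl | h
        · exact absurd hx heT
        · exact h
      exact absurd (hI T hTn this) (not_le.2 hlt')
    refine ⟨T, heT, hT, ?_⟩
    have : T ∩ I = T.erase e := by
      ext x
      simp only [Finset.mem_inter, Finset.mem_erase]
      constructor
      · rintro ⟨hx, hxI⟩
        exact ⟨fun h => he.2 (h ▸ hxI), hx⟩
      · rintro ⟨hne, hx⟩
        exact ⟨hx, (Finset.mem_insert.1 (hT hx)).resolve_left hne⟩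
    rw [this]
    have := Finset.card_erase_add_one heT
    omega
  -- a pairwise disjoint family of tight sets that covers `J \ I`
  have family : ∀ K : Finset E, K ⊆ J \ I → ∃ F : Finset (Finset E),
      (∀ T ∈ F, f T ≤ ((T ∩ I).card : ℤ)) ∧ (F : Set (Finset E)).PairwiseDisjoint id ∧
      K ⊆ F.biUnion id := by
    intro K
    induction K using Finset.induction_on with
    | empty => exact fun _ => ⟨∅, by simp, by simp, by simp⟩
    | insert e K _ ih =>
      intro hK
      obtain ⟨F, hF, hd, hc⟩ := ih ((Finset.subset_insert e K).trans hK)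
      obtain ⟨T, heT, -, hT⟩ := tight_exists e (hK (Finset.mem_insert_self e K))
      have merge : ∀ F' ⊆ F.filter (fun S => (S ∩ T).Nonempty),
          f (T ∪ F'.biUnion id) ≤ (((T ∪ F'.biUnion id) ∩ I).card : ℤ) := by
        intro F'
        induction F' using Finset.induction_on with
        | empty => intro _; simpa using hT
        | insert S F' _ ih' =>
          intro hS
          have hSF := Finset.mem_filter.1 (hS (Finset.mem_insert_self S F'))
          have h1 := ih' ((Finset.subset_insert S F').trans hS)
          have h2 : T ∪ (insert S F').biUnion id = S ∪ (T ∪ F'.biUnion id) := by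
            rw [Finset.biUnion_insert, id, Finset.union_left_comm]
          rw [h2]
          refine tight_union _ _ ?_ (hF S hSF.1) h1
          exact hSF.2.mono (Finset.inter_subset_inter_left Finset.subset_union_left)
      set F₁ := F.filter (fun S => (S ∩ T).Nonempty) with hF₁
      refine ⟨insert (T ∪ F₁.biUnion id) (F.filter (fun S => ¬ (S ∩ T).Nonempty)), ?_, ?_, ?_⟩
      · intro S hS
        rcases Finset.mem_insert.1 hS with rfl | hS
        · exact merge F₁ subset_rfl
        · exact hF S (Finset.mem_filter.1 hS).1
      · rw [Finset.coe_insert]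
        refine Set.PairwiseDisjoint.insert
          (hd.subset (Finset.coe_subset.2 (Finset.filter_subset _ _))) ?_
        intro S hS _
        have hS' := Finset.mem_filter.1 (Finset.mem_coe.1 hS)
        simp only [id]
        rw [Finset.disjoint_union_left]
        constructor
        · rw [disjoint_comm, Finset.disjoint_iff_inter_eq_empty]
          exact Finset.not_nonempty_iff_eq_empty.1 hS'.2
        · rw [Finset.disjoint_biUnion_left]
          intro S' hS''
          have h := Finset.mem_filter.1 hS''
          refine hd h.1 hS'.1 ?_
          rintro rfl
          exact hS'.2 h.2
      · intro x hx
        rw [Finset.biUnion_insert, Finset.mem_union]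
        rcases Finset.mem_insert.1 hx with rfl | hx
        · exact Or.inl (Finset.mem_union_left _ heT)
        · obtain ⟨S, hS, hxS⟩ := Finset.mem_biUnion.1 (hc hx)
          by_cases h : (S ∩ T).Nonempty
          · exact Or.inl (Finset.mem_union_right _
              (Finset.mem_biUnion.2 ⟨S, Finset.mem_filter.2 ⟨hS, h⟩, hxS⟩))
          · exact Or.inr (Finset.mem_biUnion.2 ⟨S, Finset.mem_filter.2 ⟨hS, h⟩, hxS⟩)
  obtain ⟨F, hF, hd, hc⟩ := family (J \ I) subset_rfl
  have hcard : ∀ T ∈ F, (J ∩ T).card ≤ (I ∩ T).card := by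
    intro T hT
    rw [Finset.inter_comm J, Finset.inter_comm I]
    rcases (T ∩ J).eq_empty_or_nonempty with h | h
    · simp [h]
    · have := (hJ _ h Finset.inter_subset_right).trans
        ((hf.mono _ _ Finset.inter_subset_left).trans (hF T hT))
      exact_mod_cast this
  have hsum : ∀ X : Finset E, (X ∩ F.biUnion id).card = ∑ T ∈ F, (X ∩ T).card := by
    intro X
    rw [Finset.inter_biUnion, Finset.card_biUnion]
    · rfl
    · intro S hS T hT hne
      exact (hd hS hT hne).mono Finset.inter_subset_right Finset.inter_subset_right
  have h1 : (J ∩ F.biUnion id).card ≤ (I ∩ F.biUnion id).card := by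
    rw [hsum, hsum]; exact Finset.sum_le_sum hcard
  have h2 : (J \ F.biUnion id).card ≤ (I \ F.biUnion id).card := by
    refine Finset.card_le_card fun x hx => ?_
    rw [Finset.mem_sdiff] at hx ⊢
    refine ⟨?_, hx.2⟩
    by_contra hxI
    exact hx.2 (hc (Finset.mem_sdiff.2 ⟨hx.1, hxI⟩))
  have h3 := Finset.card_inter_add_card_sdiff J (F.biUnion id)
  have h4 := Finset.card_inter_add_card_sdiff I (F.biUnion id)
  omega

/-- The matroid `M(f)` induced by `f`: its ground set is all of `E`, and a set `I` is independent
if and only if `|J| ≤ f J` for all nonempty `J ⊆ I`. -/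
def inducedMatroid [Finite E] (f : Finset E → ℤ) (hf : IsMatroidInducing f) : Matroid E :=
  (IndepMatroid.ofFinset Set.univ (InducedIndep f)
    (fun _ hJ hsub => absurd (Finset.subset_empty.1 hsub) hJ.ne_empty)
    (fun _ _ hJ hIJ K hK hKI => hJ K hK (hKI.trans hIJ))
    (fun _ _ hI hJ hlt => InducedIndep.augment hf hI hJ hlt)
    (fun _ _ => Set.subset_univ _)).matroid

theorem inducedMatroid_indep_iff [Finite E] (f : Finset E → ℤ) (hf : IsMatroidInducing f)
    (I : Finset E) : (inducedMatroid f hf).Indep (I : Set E) ↔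
      ∀ J : Finset E, J.Nonempty → J ⊆ I → (J.card : ℤ) ≤ f J := by
  simp only [inducedMatroid, IndepMatroid.matroid_indep_iff]
  exact IndepMatroid.ofFinset_indep ..

end InducedMatroid

section MatroidUnion

variable {E : Type*}

/-- Independence in the union of two matroids. -/
def UnionIndep (M N : Matroid E) (I : Set E) : Prop :=
  ∃ I₁ I₂ : Set E, M.Indep I₁ ∧ N.Indep I₂ ∧ I = I₁ ∪ I₂

theorem UnionIndep.augment [Finite E] {M N : Matroid E} {I J : Set E}
    (hI : UnionIndep M N I) (hJ : UnionIndep M N J) (hlt : I.ncard < J.ncard) :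
    ∃ e ∈ J, e ∉ I ∧ UnionIndep M N (insert e I) := by
  classical
  have disj : ∀ X : Set E, UnionIndep M N X →
      ∃ X₁ X₂, M.Indep X₁ ∧ N.Indep X₂ ∧ Disjoint X₁ X₂ ∧ X = X₁ ∪ X₂ := by
    rintro X ⟨X₁, X₂, h₁, h₂, rfl⟩
    exact ⟨X₁, X₂ \ X₁, h₁, h₂.subset Set.sdiff_subset, Set.disjoint_sdiff_right,
      Set.union_sdiff_self.symm⟩
  obtain ⟨J₁, J₂, hJ₁, hJ₂, hJd, rfl⟩ := disj J hJ
  by_contra! hcon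
  -- moving one element between the parts of `I` always increases the overlap with `J₁`, `J₂`
  have step : ∀ n : ℕ, ∃ I₁ I₂, M.Indep I₁ ∧ N.Indep I₂ ∧ Disjoint I₁ I₂ ∧ I = I₁ ∪ I₂ ∧
      n ≤ (I₁ ∩ J₁).ncard + (I₂ ∩ J₂).ncard := by
    intro n
    induction n with
    | zero =>
      obtain ⟨I₁, I₂, h₁, h₂, hd, h⟩ := disj I hI
      exact ⟨I₁, I₂, h₁, h₂, hd, h, Nat.zero_le _⟩
    | succ n ih =>
      obtain ⟨I₁, I₂, h₁, h₂, hd, rfl, hn⟩ := ih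
      rw [Set.ncard_union_eq hd, Set.ncard_union_eq hJd] at hlt
      have hor : I₁.ncard < J₁.ncard ∨ I₂.ncard < J₂.ncard := by omega
      rcases hor with hlt' | hlt'
      · obtain ⟨e, he, hins⟩ := h₁.augment hJ₁ (by
          rw [← (Set.toFinite I₁).cast_ncard_eq, ← (Set.toFinite J₁).cast_ncard_eq]
          exact_mod_cast hlt')
        have heI₂ : e ∈ I₂ := by
          by_contra h
          exact hcon e (Or.inl he.1) (fun h' => h'.elim he.2 h)
            ⟨insert e I₁, I₂, hins, h₂, Set.insert_union.symm⟩
        have heJ₂ : e ∉ J₂ := Set.disjoint_left.1 hJd he.1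
        refine ⟨insert e I₁, I₂ \ {e}, hins, h₂.subset Set.sdiff_subset, ?_, ?_, ?_⟩
        · rw [Set.disjoint_left]
          rintro x (rfl | hx) ⟨hx₂, hne⟩
          · exact hne rfl
          · exact Set.disjoint_left.1 hd hx hx₂
        · ext x
          by_cases hx : x = e <;> simp [hx, heI₂]
        · have e1 : insert e I₁ ∩ J₁ = insert e (I₁ ∩ J₁) := Set.insert_inter_of_mem he.1
          have e2 : (I₂ \ {e}) ∩ J₂ = I₂ ∩ J₂ := by
            ext x
            by_cases hx : x = e <;> simp [hx, heJ₂]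
          rw [e1, e2, Set.ncard_insert_of_notMem (fun h => he.2 h.1)]
          omega
      · obtain ⟨e, he, hins⟩ := h₂.augment hJ₂ (by
          rw [← (Set.toFinite I₂).cast_ncard_eq, ← (Set.toFinite J₂).cast_ncard_eq]
          exact_mod_cast hlt')
        have heI₁ : e ∈ I₁ := by
          by_contra h
          exact hcon e (Or.inr he.1) (fun h' => h'.elim h he.2)
            ⟨I₁, insert e I₂, h₁, hins, Set.union_insert.symm⟩
        have heJ₁ : e ∉ J₁ := fun h => Set.disjoint_left.1 hJd h he.1
        refine ⟨I₁ \ {e}, insert e I₂, h₁.subset Set.sdiff_subset, hins, ?_, ?_, ?_⟩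
        · rw [Set.disjoint_right]
          rintro x (rfl | hx) ⟨hx₂, hne⟩
          · exact hne rfl
          · exact Set.disjoint_left.1 hd hx₂ hx
        · ext x
          by_cases hx : x = e <;> simp [hx, heI₁]
        · have e1 : insert e I₂ ∩ J₂ = insert e (I₂ ∩ J₂) := Set.insert_inter_of_mem he.1
          have e2 : (I₁ \ {e}) ∩ J₁ = I₁ ∩ J₁ := by
            ext x
            by_cases hx : x = e <;> simp [hx, heJ₁]
          rw [e1, e2, Set.ncard_insert_of_notMem (fun h => he.2 h.1)]
          omega
  obtain ⟨I₁, I₂, -, -, hd, rfl, hn⟩ := step ((I.ncard) + 1)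
  rw [Set.ncard_union_eq hd] at hn
  have := Set.ncard_le_ncard (Set.inter_subset_left (s := I₁) (t := J₁))
  have := Set.ncard_le_ncard (Set.inter_subset_left (s := I₂) (t := J₂))
  omega

/-- The matroid union `M ∨ N`: its independent sets are the sets `I₁ ∪ I₂` with `I₁` independent
in `M` and `I₂` independent in `N`. -/
def matroidUnion [Finite E] (M N : Matroid E) : Matroid E :=
  (IndepMatroid.ofFinite (Set.toFinite (M.E ∪ N.E)) (UnionIndep M N)
    ⟨∅, ∅, M.empty_indep, N.empty_indep, (Set.union_empty _).symm⟩
    (fun I J hJ hIJ => by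
      obtain ⟨J₁, J₂, h₁, h₂, rfl⟩ := hJ
      exact ⟨I ∩ J₁, I ∩ J₂, h₁.subset Set.inter_subset_right, h₂.subset Set.inter_subset_right,
        by rw [← Set.inter_union_distrib_left, Set.inter_eq_left.2 hIJ]⟩)
    (fun _ _ hI hJ hlt => UnionIndep.augment hI hJ hlt)
    (fun I hI => by
      obtain ⟨I₁, I₂, h₁, h₂, rfl⟩ := hI
      exact Set.union_subset_union h₁.subset_ground h₂.subset_ground)).matroid

theorem matroidUnion_indep_iff [Finite E] (M N : Matroid E) (I : Set E) :
    (matroidUnion M N).Indep I ↔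
      ∃ I₁ I₂ : Set E, M.Indep I₁ ∧ N.Indep I₂ ∧ I = I₁ ∪ I₂ := by
  simp only [matroidUnion, IndepMatroid.matroid_indep_iff]
  exact Iff.rfl

end MatroidUnion

section RowMatroid

variable {E κ : Type*}

theorem linearIndepOn_row_augment [Finite E] (A : Matrix E κ ℝ) {I J : Set E}
    (hI : LinearIndepOn ℝ A.row I) (hJ : LinearIndepOn ℝ A.row J) (hlt : I.ncard < J.ncard) :
    ∃ e ∈ J, e ∉ I ∧ LinearIndepOn ℝ A.row (insert e I) := by
  classical
  by_contra! hcon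
  have hsub : Submodule.span ℝ (A.row '' J) ≤ Submodule.span ℝ (A.row '' I) := by
    rw [Submodule.span_le]
    rintro _ ⟨e, he, rfl⟩
    by_cases heI : e ∈ I
    · exact Submodule.subset_span ⟨e, heI, rfl⟩
    · by_contra hspan
      exact hcon e he heI (hI.insert hspan)
  have card_eq : ∀ X : Set E, LinearIndepOn ℝ A.row X →
      Module.finrank ℝ (Submodule.span ℝ (A.row '' X)) = X.ncard := by
    intro X hX
    have : Fintype X := Fintype.ofFinite X
    have h := finrank_span_eq_card (R := ℝ) (b := fun x : X => A.row x) hX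
    rw [Set.image_eq_range, h, ← Nat.card_eq_fintype_card, Nat.card_coe_set_eq]
  have : FiniteDimensional ℝ (Submodule.span ℝ (A.row '' I)) :=
    FiniteDimensional.span_of_finite ℝ (Set.toFinite _)
  have h := Submodule.finrank_mono hsub
  rw [card_eq I hI, card_eq J hJ] at h
  omega

/-- The row matroid of a real matrix with rows indexed by `E`: a set of row indices is independent
if and only if the family of rows that it indexes is linearly independent over `ℝ`. -/
def rowMatroid [Finite E] (A : Matrix E κ ℝ) : Matroid E :=
  (IndepMatroid.ofFinite (Set.toFinite Set.univ) (fun I => LinearIndepOn ℝ A.row I)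
    (linearIndepOn_empty ℝ A.row)
    (fun _ _ hJ hIJ => hJ.mono hIJ)
    (fun _ _ hI hJ hlt => linearIndepOn_row_augment A hI hJ hlt)
    (fun _ _ => Set.subset_univ _)).matroid

theorem rowMatroid_indep_iff [Finite E] (A : Matrix E κ ℝ) (I : Set E) :
    (rowMatroid A).Indep I ↔ LinearIndepOn ℝ A.row I := by
  simp [rowMatroid]

end RowMatroid

/-! ### The counts and the matrices of a point-line frame -/

namespace BipartiteMultigraph

variable {P L E : Type*} [DecidableEq P] [DecidableEq L] [DecidableEq E]

/-- `ν_P(S)`: the number of point-vertices incident to an edge of `S`. -/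
def nuP (G : BipartiteMultigraph P L E) (S : Finset E) : ℤ := ((S.image G.pt).card : ℤ)

/-- `ν_L(S)`: the number of line-vertices incident to an edge of `S`. -/
def nuL (G : BipartiteMultigraph P L E) (S : Finset E) : ℤ := ((S.image G.ln).card : ℤ)

/-- The matrix `A(G,t,c)`: each vertex has two columns. -/
def matrixA (G : BipartiteMultigraph P L E) (t : L → ℝ) (c : E → ℝ) :
    Matrix E ((P ⊕ L) × Fin 2) ℝ :=
  Matrix.of fun e k =>
    match k with
    | (Sum.inl u, i) => if u = G.pt e then ![1, t (G.ln e)] i else 0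
    | (Sum.inr v, i) => if v = G.ln e then ![c e, -1] i else 0

/-- The matrix `B(G,c)`: each point-vertex has two columns, each line-vertex has one. -/
def matrixB (G : BipartiteMultigraph P L E) (c : E → ℝ) : Matrix E ((P × Fin 2) ⊕ L) ℝ :=
  Matrix.of fun e k =>
    match k with
    | Sum.inl (u, i) => if u = G.pt e then ![1, c e] i else 0
    | Sum.inr v => if v = G.ln e then -1 else 0

/-- The matrix `C(G,t)`: each point-vertex has two columns, each line-vertex has one. -/
def matrixC (G : BipartiteMultigraph P L E) (t : L → ℝ) : Matrix E ((P × Fin 2) ⊕ L) ℝ :=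
  Matrix.of fun e k =>
    match k with
    | Sum.inl (u, i) => if u = G.pt e then ![1, t (G.ln e)] i else 0
    | Sum.inr v => if v = G.ln e then -1 else 0

/-- The frame `(G,t,c)` is generic: the numbers `t v` (`v` a line-vertex) and `c e` (`e` an edge)
form an algebraically independent family over `ℚ`. -/
def IsGenericFrame (_G : BipartiteMultigraph P L E) (t : L → ℝ) (c : E → ℝ) : Prop :=
  AlgebraicIndependent ℚ (Sum.elim t c)

theorem card_image_submod {V : Type*} [DecidableEq V] (g : E → V) (S T : Finset E) :
    (((S ∪ T).image g).card : ℤ) + (((S ∩ T).image g).card : ℤ) ≤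
      ((S.image g).card : ℤ) + ((T.image g).card : ℤ) := by
  have h1 := Finset.card_union_add_card_inter (S.image g) (T.image g)
  have h2 := Finset.card_le_card (Finset.image_inter_subset g S T)
  rw [Finset.image_union]
  omega

theorem one_le_card_image {V : Type*} [DecidableEq V] (g : E → V) (S : Finset E)
    (hS : S.Nonempty) : (1 : ℤ) ≤ ((S.image g).card : ℤ) := by
  have := (hS.image g).card_pos
  omega

theorem card_image_mono {V : Type*} [DecidableEq V] (g : E → V) (S T : Finset E)
    (h : S ⊆ T) : ((S.image g).card : ℤ) ≤ ((T.image g).card : ℤ) := by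
  exact_mod_cast Finset.card_le_card (Finset.image_subset_image h)

theorem isMatroidInducing_two_nuP_add_nuL_sub_one (G : BipartiteMultigraph P L E) :
    IsMatroidInducing (fun S => 2 * G.nuP S + G.nuL S - 1) where
  mono S T h := by
    have h1 := card_image_mono G.pt S T h
    have h2 := card_image_mono G.ln S T h
    simp only [nuP, nuL]
    linarith
  submod S T _ := by
    have h1 := card_image_submod G.pt S T
    have h2 := card_image_submod G.ln S T
    simp only [nuP, nuL]
    linarith
  nonneg S hS := by
    have h1 := one_le_card_image G.pt S hS
    have h2 := one_le_card_image G.ln S hS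
    simp only [nuP, nuL]
    linarith

theorem isMatroidInducing_two_nuP_add_nuL_sub_two (G : BipartiteMultigraph P L E) :
    IsMatroidInducing (fun S => 2 * G.nuP S + G.nuL S - 2) where
  mono S T h := by
    have h1 := card_image_mono G.pt S T h
    have h2 := card_image_mono G.ln S T h
    simp only [nuP, nuL]
    linarith
  submod S T _ := by
    have h1 := card_image_submod G.pt S T
    have h2 := card_image_submod G.ln S T
    simp only [nuP, nuL]
    linarith
  nonneg S hS := by
    have h1 := one_le_card_image G.pt S hS
    have h2 := one_le_card_image G.ln S hS
    simp only [nuP, nuL]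
    linarith

theorem isMatroidInducing_nuL (G : BipartiteMultigraph P L E) :
    IsMatroidInducing (fun S => G.nuL S) where
  mono S T h := card_image_mono G.ln S T h
  submod S T _ := card_image_submod G.ln S T
  nonneg S hS := by
    have h2 := one_le_card_image G.ln S hS
    simp only [nuL]
    linarith

end BipartiteMultigraph

/-! ### Row independence of matrices with polynomial entries -/

/-! `B` and `C` are both instances of `slopeMatrix`: the row of an edge is (1, slope) at its point
and -1 at its line, with slope `c e` for `B` and `t (ln e)` for `C`. A row dependency is a stress.

Independence forces sparsity because of column relations. The first point columns and the line
columns always sum to zero, which costs 1. When the slope depends only on the line, the second point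
columns plus `t`-multiples of the line columns also sum to zero, which makes the cost 2.

Sparsity gives independence by induction on the number of edges. A point of degree at most 2 carries
no stress, since slopes at a point are distinct, so it can be deleted. If all point degrees are at
least 3, counting gives a line of degree 1 or 2. A degree 1 edge can be deleted. If the line has two
edges `e` and `f`, the slope of `e` is specialized to that of another edge `g` at the same point,
and the coefficient of `e` is transferred to `g`. This turns a stress into one of the smaller graph
without `e` and with `f` moved to the line of `g` (`linearIndepOn_of_moveLine`). An uncrossing
argument with tight sets finds a `g` that keeps the smaller graph sparse (`Sparse.exists_moveLine`).
Independence at the special parameters passes to generic ones because a Gram determinant is a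
polynomial.

For `A`, each row is a row of `C` plus `c e` times a unit vector at the line. Multilinearity of the
determinant splits an independent set into a `C`-independent part and a part with distinct lines;
conversely, such a pair is realized by a 0/1 choice of `c`. -/

/-- A family of real rows is independent if and only if its Gram determinant is nonzero. -/
theorem linearIndependent_row_iff_det_mul_transpose_ne_zero {m κ : Type*} [Fintype m]
    [DecidableEq m] [Fintype κ] (A : Matrix m κ ℝ) :
    LinearIndependent ℝ A.row ↔ (A * A.transpose).det ≠ 0 := by
  rw [← Matrix.vecMul_injective_iff, ne_eq, ← Matrix.exists_vecMul_eq_zero_iff]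
  have key : ∀ v, Matrix.vecMul v (A * A.transpose) = 0 ↔ Matrix.vecMul v A = 0 := fun v => by
    simpa using Matrix.vecMul_self_mul_conjTranspose_eq_zero A v
  constructor
  · rintro h ⟨v, hv, h0⟩
    exact hv (h (by simpa using (key v).1 h0))
  · intro h v w hvw
    by_contra hne
    refine h ⟨v - w, sub_ne_zero.2 hne, (key _).2 ?_⟩
    rw [Matrix.sub_vecMul, sub_eq_zero]
    exact hvw

/-- If rows of a matrix with polynomial entries are independent at some real specialization, then
they are independent at every algebraically independent one. -/
theorem linearIndepOn_row_of_algebraicIndependent {E κ σ : Type*} [Finite E] [Fintype κ]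
    (M : Matrix E κ (MvPolynomial σ ℚ)) {x : σ → ℝ} (hx : AlgebraicIndependent ℚ x) (y : σ → ℝ)
    {I : Set E} (h : LinearIndepOn ℝ (M.map (MvPolynomial.aeval y)).row I) :
    LinearIndepOn ℝ (M.map (MvPolynomial.aeval x)).row I := by
  classical
  have : Fintype I := Fintype.ofFinite I
  set N : Matrix I κ (MvPolynomial σ ℚ) := M.submatrix (fun i : I => (i : E)) id
  -- The Gram determinant encodes independence of a rectangular family in a single polynomial, so no
  -- minor has to be chosen.
  have gram : ∀ z : σ → ℝ, LinearIndepOn ℝ (M.map (MvPolynomial.aeval z)).row I ↔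
      MvPolynomial.aeval z (N * N.transpose).det ≠ 0 := by
    intro z
    rw [AlgHom.map_det, AlgHom.mapMatrix_apply, Matrix.map_mul, Matrix.transpose_map]
    exact linearIndependent_row_iff_det_mul_transpose_ne_zero
      (N.map (MvPolynomial.aeval z : MvPolynomial σ ℚ →ₐ[ℚ] ℝ))
  rw [gram] at h ⊢
  intro h0
  apply h
  rw [(injective_iff_map_eq_zero _).1 hx _ h0, map_zero]

/-- If the sums `x i + z i` are linearly independent, then the index set splits into a part on
which `x` and a part on which `z` is linearly independent. -/
theorem LinearIndependent.exists_piecewise {ι V : Type*} [Fintype ι] [DecidableEq ι]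
    [AddCommGroup V] [Module ℝ V] {x z : ι → V} (h : LinearIndependent ℝ (x + z)) :
    ∃ S : Finset ι, LinearIndependent ℝ (S.piecewise x z) := by
  obtain ⟨φ, hφ⟩ := LinearMap.exists_leftInverse_of_injective
    (Fintype.linearCombination ℝ (x + z)) (
      LinearMap.ker_eq_bot.2 h.fintypeLinearCombination_injective)
  have hb : ∀ i, φ ((x + z) i) = Pi.single i 1 := fun i => by
    have := LinearMap.congr_fun hφ (Pi.single i 1)
    simpa [Fintype.linearCombination_apply_single] using this
  -- `φ` sends the sums to the standard basis, so `D` is 1 on them. Expanding `D` over all choices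
  -- of `x i` or `z i` leaves a nonzero term.
  let D : MultilinearMap ℝ (fun _ : ι => V) ℝ :=
    (Matrix.detRowAlternating (R := ℝ) (n := ι)).toMultilinearMap.compLinearMap (fun _ => φ)
  have hD : ∀ w, D w = (Matrix.of fun i => φ (w i)).det := fun w => rfl
  have h1 : D (x + z) = 1 := by
    rw [hD, ← Matrix.det_one (n := ι) (R := ℝ)]
    congr 1
    ext i j
    rw [Matrix.of_apply, hb, Matrix.one_apply, Pi.single_apply]
    simp only [eq_comm]
  rw [D.map_add_univ] at h1
  obtain ⟨S, -, hS⟩ := Finset.exists_ne_zero_of_sum_ne_zero (h1.trans_ne one_ne_zero)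
  refine ⟨S, LinearIndependent.of_comp φ ?_⟩
  rw [hD] at hS
  exact Matrix.linearIndependent_rows_of_det_ne_zero hS

/-- A set of rows that is annihilated only by the zero combination already on the columns `K` has
at most `K.card` elements. -/
theorem card_le_card_of_forall_sum_eq_zero {E κ : Type*} (A : Matrix E κ ℝ) (J : Finset E)
    (K : Finset κ)
    (h : ∀ l : E → ℝ, (∀ k ∈ K, ∑ e ∈ J, l e * A e k = 0) → ∀ e ∈ J, l e = 0) :
    J.card ≤ K.card := by
  classical
  have hli : LinearIndepOn ℝ (fun e (k : K) => A e k) (J : Set E) := by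
    rw [linearIndepOn_finset_iff]
    intro l hl
    refine h l fun k hk => ?_
    simpa using congrFun hl ⟨k, hk⟩
  simpa using hli.fintype_card_le_finrank

/-! ### Sparse edge sets -/

namespace BipartiteMultigraph

variable {P L E : Type*} [DecidableEq P] [DecidableEq L] [DecidableEq E]

/-- Every nonempty `J ⊆ I` satisfies `|J| ≤ 2 ν_P(J) + ν_L(J) - k`. -/
def Sparse (G : BipartiteMultigraph P L E) (k : ℕ) (I : Finset E) : Prop :=
  ∀ J : Finset E, J.Nonempty → J ⊆ I → J.card + k ≤ 2 * (J.image G.pt).card + (J.image G.ln).card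

/-- The graph in which the line-end of the edge `f` is moved to `a`. -/
def moveLine (G : BipartiteMultigraph P L E) (f : E) (a : L) : BipartiteMultigraph P L E where
  pt := G.pt
  ln := Function.update G.ln f a

theorem Sparse.mono {G : BipartiteMultigraph P L E} {k : ℕ} {I J : Finset E}
    (h : G.Sparse k I) (hJ : J ⊆ I) : G.Sparse k J :=
  fun K hK hKJ => h K hK (hKJ.trans hJ)

/-- One point and one line allow 2 + 1 - 2 = 1 edge. This makes the slopes at a point distinct when
they come from the lines. -/
theorem Sparse.eq_of_parallel {G : BipartiteMultigraph P L E} {I : Finset E}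
    (h : G.Sparse 2 I) {e f : E} (he : e ∈ I) (hf : f ∈ I) (hp : G.pt e = G.pt f)
    (hl : G.ln e = G.ln f) : e = f := by
  by_contra hne
  have := h {e, f} (by simp) (by simp [Finset.insert_subset_iff, he, hf])
  simp [Finset.image_insert, hp, hl, Finset.card_pair hne] at this

/-- A nonempty sparse set in which every point-vertex has degree at least three has a line-vertex
of degree one or two. -/
theorem Sparse.exists_line_card_le_two {G : BipartiteMultigraph P L E} {k : ℕ} {I : Finset E}
    (hk : 1 ≤ k) (h : G.Sparse k I) (hI : I.Nonempty)
    (hdeg : ∀ u ∈ I.image G.pt, 3 ≤ (I.filter (fun x => G.pt x = u)).card) :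
    ∃ v ∈ I.image G.ln, (I.filter (fun x => G.ln x = v)).card ≤ 2 := by
  by_contra! hcon
  -- Twice the point bound plus the line bound gives |I| ≥ 2 ν_P + ν_L, which `1 ≤ k` excludes.
  have h1 := Finset.mul_card_image_le_card I 3 hdeg
  have h2 := Finset.mul_card_image_le_card I 3 hcon
  have h3 := h I hI subset_rfl
  omega

/-- If moving the line-end of `f` to that of `g` destroys sparsity, there is a tight set spanning
the point of `f` and the line of `g`. -/
theorem Sparse.exists_tight {G : BipartiteMultigraph P L E} {k : ℕ} {I : Finset E}
    (hk : k ≤ 2) (h : G.Sparse k I) {e f : E} {a : L}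
    (hnot : ¬ (G.moveLine f a).Sparse k (I.erase e)) :
    ∃ K ⊆ (I.erase e).erase f, G.pt f ∈ K.image G.pt ∧ a ∈ K.image G.ln ∧
      2 * (K.image G.pt).card + (K.image G.ln).card ≤ K.card + k := by
  unfold Sparse at hnot
  push Not at hnot
  obtain ⟨J, hJn, hJ, hlt⟩ := hnot
  have himg : ∀ K : Finset E, f ∉ K → K.image (G.moveLine f a).ln = K.image G.ln := by
    intro K hK
    refine Finset.image_congr fun x hx => ?_
    exact Function.update_of_ne (ne_of_mem_of_not_mem (Finset.mem_coe.1 hx) hK) _ _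
  have hpt : (G.moveLine f a).pt = G.pt := rfl
  rw [hpt] at hlt
  have hfJ : f ∈ J := by
    by_contra hfJ
    rw [himg J hfJ] at hlt
    exact absurd (h J hJn (hJ.trans (Finset.erase_subset _ _))) (not_le.2 hlt)
  have hfK : f ∉ J.erase f := Finset.notMem_erase f J
  have hKI : J.erase f ⊆ (I.erase e).erase f := Finset.erase_subset_erase f hJ
  obtain ⟨K, hK⟩ : ∃ K, K = J.erase f := ⟨_, rfl⟩
  rw [← hK] at hfK hKI
  have hJK : J = insert f K := by rw [hK, Finset.insert_erase hfJ]
  have hfa : (G.moveLine f a).ln f = a := Function.update_self ..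
  rw [hJK, Finset.image_insert, Finset.image_insert, himg K hfK, hfa,
    Finset.card_insert_of_notMem hfK] at hlt
  rcases K.eq_empty_or_nonempty with rfl | hKn
  · simp at hlt
    omega
  · have h1 := h K hKn (hKI.trans ((Finset.erase_subset _ _).trans (Finset.erase_subset _ _)))
    -- `K` meets the count and `K` with the moved `f` exceeds it, so the one extra edge brings no
    -- new vertex and `K` has no slack.
    refine ⟨K, hKI, ?_, ?_, ?_⟩
    · by_contra hc
      rw [Finset.card_insert_of_notMem hc] at hlt
      have := Finset.card_le_card (Finset.subset_insert a (K.image G.ln))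
      omega
    · by_contra hc
      rw [Finset.card_insert_of_notMem hc] at hlt
      have := Finset.card_le_card (Finset.subset_insert (G.pt f) (K.image G.pt))
      omega
    · have := Finset.card_le_card (Finset.subset_insert a (K.image G.ln))
      have := Finset.card_le_card (Finset.subset_insert (G.pt f) (K.image G.pt))
      omega

/-- Tight sets that share a point-vertex have a tight union. -/
theorem Sparse.tight_union {G : BipartiteMultigraph P L E} {k : ℕ} {I : Finset E}
    (hk : k ≤ 2) (h : G.Sparse k I) {A B : Finset E} (hA : A ⊆ I) {u : P}
    (huA : u ∈ A.image G.pt) (huB : u ∈ B.image G.pt)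
    (htA : 2 * (A.image G.pt).card + (A.image G.ln).card ≤ A.card + k)
    (htB : 2 * (B.image G.pt).card + (B.image G.ln).card ≤ B.card + k) :
    2 * ((A ∪ B).image G.pt).card + ((A ∪ B).image G.ln).card ≤ (A ∪ B).card + k := by
  have h1 := Finset.card_union_add_card_inter (A.image G.pt) (B.image G.pt)
  have h2 := Finset.card_union_add_card_inter (A.image G.ln) (B.image G.ln)
  have h3 := Finset.card_union_add_card_inter A B
  rw [← Finset.image_union] at h1 h2
  have h4 := Finset.card_le_card (Finset.image_inter_subset G.pt A B)
  have h5 := Finset.card_le_card (Finset.image_inter_subset G.ln A B)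
  -- With no common edge, the shared point saves 2, which covers `k ≤ 2`; otherwise sparsity of the
  -- intersection is used.
  rcases (A ∩ B).eq_empty_or_nonempty with h0 | h0
  · have : 0 < (A.image G.pt ∩ B.image G.pt).card :=
      Finset.card_pos.2 ⟨u, Finset.mem_inter.2 ⟨huA, huB⟩⟩
    rw [h0, Finset.card_empty] at h3
    omega
  · have := h _ h0 (Finset.inter_subset_left.trans hA)
    omega

/-- Two edges at the same line-vertex cannot both be spanned by a tight set on the point side. -/
theorem Sparse.not_tight_of_pt_mem {G : BipartiteMultigraph P L E} {k : ℕ} {I K : Finset E}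
    (h : G.Sparse k I) {e f : E} (he : e ∈ I) (hf : f ∈ I) (hef : e ≠ f)
    (hl : G.ln f = G.ln e) (hK : K ⊆ (I.erase e).erase f) (hpe : G.pt e ∈ K.image G.pt)
    (hpf : G.pt f ∈ K.image G.pt) :
    K.card + k < 2 * (K.image G.pt).card + (K.image G.ln).card := by
  have hfK : f ∉ K := fun hx => by simpa using hK hx
  have heK : e ∉ insert f K := fun hx => by
    rcases Finset.mem_insert.1 hx with hx | hx
    · exact hef hx
    · simpa using hK hx
  -- Adding `e` and `f` gives two edges but at most one new vertex, the line `ln e`, counted once.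
  have h1 := h (insert e (insert f K)) (Finset.insert_nonempty _ _) (by
    refine Finset.insert_subset he (Finset.insert_subset hf ?_)
    exact hK.trans ((Finset.erase_subset _ _).trans (Finset.erase_subset _ _)))
  rw [Finset.card_insert_of_notMem heK, Finset.card_insert_of_notMem hfK] at h1
  simp only [Finset.image_insert] at h1
  rw [Finset.insert_eq_of_mem hpf, Finset.insert_eq_of_mem hpe, hl, Finset.insert_idem] at h1
  have := Finset.card_insert_le (G.ln e) (K.image G.ln)
  omega

/-- A tight set missing the point-vertex `pt e` spans at most one line-vertex over which
`pt e` sees an edge, provided it spans the other point at `ln e`. -/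
theorem Sparse.not_tight_of_pt_notMem {G : BipartiteMultigraph P L E} {k : ℕ} {I K : Finset E}
    (h : G.Sparse k I) {e f g g' : E} (he : e ∈ I) (hf : f ∈ I) (hg : g ∈ I) (hg' : g' ∈ I)
    (hge : g ≠ e) (hge' : g' ≠ e) (hgg : g ≠ g') (hpg : G.pt g = G.pt e) (hpg' : G.pt g' = G.pt e)
    (hef : G.pt f ≠ G.pt e) (hl : G.ln f = G.ln e) (hK : K ⊆ (I.erase e).erase f)
    (hpe : G.pt e ∉ K.image G.pt) (hpf : G.pt f ∈ K.image G.pt) (hlg : G.ln g ∈ K.image G.ln)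
    (hlg' : G.ln g' ∈ K.image G.ln) :
    K.card + k < 2 * (K.image G.pt).card + (K.image G.ln).card := by
  have hnot : ∀ x, G.pt x = G.pt e → x ∉ insert f K := by
    intro x hx hxK
    rcases Finset.mem_insert.1 hxK with rfl | hxK
    · exact hef hx
    · exact hpe (hx ▸ Finset.mem_image_of_mem _ hxK)
  have hfK : f ∉ K := fun hx => by simpa using hK hx
  -- Four new edges against at most 3 on the vertex side: 2 for the point `pt e` and 1 for the line
  -- `ln e`.
  have h1 := h (insert g (insert g' (insert e (insert f K)))) (Finset.insert_nonempty _ _) (by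
    refine Finset.insert_subset hg (Finset.insert_subset hg' (Finset.insert_subset he
      (Finset.insert_subset hf ?_)))
    exact hK.trans ((Finset.erase_subset _ _).trans (Finset.erase_subset _ _)))
  rw [Finset.card_insert_of_notMem, Finset.card_insert_of_notMem,
    Finset.card_insert_of_notMem (hnot e rfl), Finset.card_insert_of_notMem hfK] at h1
  · simp only [Finset.image_insert, hpg, hpg', hl, Finset.insert_idem] at h1
    rw [Finset.insert_eq_of_mem hpf, Finset.card_insert_of_notMem hpe,
      Finset.insert_eq_of_mem (Finset.mem_insert_of_mem hlg' :
        G.ln g' ∈ insert (G.ln e) (K.image G.ln)),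
      Finset.insert_eq_of_mem (Finset.mem_insert_of_mem hlg :
        G.ln g ∈ insert (G.ln e) (K.image G.ln))] at h1
    have := Finset.card_insert_le (G.ln e) (K.image G.ln)
    omega
  · rw [Finset.mem_insert, not_or]
    exact ⟨hge', hnot g' hpg'⟩
  · rw [Finset.mem_insert, Finset.mem_insert, not_or, not_or]
    exact ⟨hgg, hge, hnot g hpg⟩

/-- At a line-vertex with the two edges `e` and `f`, the edge `e` can be deleted and `f` moved to
the line-end of another edge `g` at `pt e` while keeping sparsity. -/
theorem Sparse.exists_moveLine {G : BipartiteMultigraph P L E} {k : ℕ} {I : Finset E}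
    (hk : k ≤ 2) (h : G.Sparse k I) {e f : E} (he : e ∈ I) (hf : f ∈ I) (hef : e ≠ f)
    (hl : G.ln f = G.ln e)
    (hdeg : 3 ≤ (I.filter (fun x => G.pt x = G.pt e)).card) :
    ∃ g ∈ I, g ≠ e ∧ g ≠ f ∧ G.pt g = G.pt e ∧
      (G.moveLine f (G.ln g)).Sparse k (I.erase e) := by
  have hsub : ∀ K : Finset E, K ⊆ (I.erase e).erase f → K ⊆ I := fun K hK =>
    hK.trans ((Finset.erase_subset _ _).trans (Finset.erase_subset _ _))
  obtain ⟨g, hg, hgn⟩ : ∃ g ∈ I.filter (fun x => G.pt x = G.pt e), g ∉ ({e, f} : Finset E) :=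
    Finset.exists_mem_notMem_of_card_lt_card
      (lt_of_le_of_lt Finset.card_le_two (by omega))
  simp only [Finset.mem_filter, Finset.mem_insert, Finset.mem_singleton, not_or] at hg hgn
  by_contra! hcon
  obtain ⟨K, hK, hKf, hKg, hKt⟩ := h.exists_tight hk (hcon g hg.1 hgn.1 hgn.2 hg.2)
  have hKe : G.pt e ∉ K.image G.pt := fun hc =>
    absurd (h.not_tight_of_pt_mem he hf hef hl hK hc hKf) (not_lt.2 hKt)
  have hpef : G.pt f ≠ G.pt e := fun hc => hKe (hc ▸ hKf)
  -- Since `f` is not at `pt e`, a third edge there need only avoid `e` and `g`. The two obstructing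
  -- tight sets share `pt f`, so their union is tight and spans both `ln g` and `ln g'`.
  obtain ⟨g', hg', hgn'⟩ : ∃ g' ∈ I.filter (fun x => G.pt x = G.pt e),
      g' ∉ ({e, g} : Finset E) :=
    Finset.exists_mem_notMem_of_card_lt_card
      (lt_of_le_of_lt Finset.card_le_two (by omega))
  simp only [Finset.mem_filter, Finset.mem_insert, Finset.mem_singleton, not_or] at hg' hgn'
  obtain ⟨K', hK', hKf', hKg', hKt'⟩ := h.exists_tight hk
    (hcon g' hg'.1 hgn'.1 (fun hc => hpef (hc ▸ hg'.2)) hg'.2)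
  have hKe' : G.pt e ∉ K'.image G.pt := fun hc =>
    absurd (h.not_tight_of_pt_mem he hf hef hl hK' hc hKf') (not_lt.2 hKt')
  have ht := h.tight_union hk (hsub K hK) hKf hKf' hKt hKt'
  refine absurd (h.not_tight_of_pt_notMem he hf hg.1 hg'.1 hgn.1 hgn'.1 (Ne.symm hgn'.2) hg.2 hg'.2
    hpef hl (Finset.union_subset hK hK') ?_ ?_ ?_ ?_) (not_lt.2 ht)
  all_goals rw [Finset.image_union, Finset.mem_union]
  · exact not_or.2 ⟨hKe, hKe'⟩
  · exact Or.inl hKf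
  · exact Or.inl hKg
  · exact Or.inr hKg'

end BipartiteMultigraph

/-! ### Matrices with a slope for each edge -/

namespace BipartiteMultigraph

variable {P L E : Type*} [DecidableEq P] [DecidableEq L] [DecidableEq E]

/-- The matrix with `(1, s e)` in the columns of `pt e` and `-1` in the column of `ln e`. -/
def slopeMatrix {R : Type*} [CommRing R] (G : BipartiteMultigraph P L E) (s : E → R) :
    Matrix E ((P × Fin 2) ⊕ L) R :=
  Matrix.of fun e k =>
    match k with
    | Sum.inl (u, i) => if u = G.pt e then ![1, s e] i else 0
    | Sum.inr v => if v = G.ln e then -1 else 0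

theorem slopeMatrix_map {R S : Type*} [CommRing R] [CommRing S] (G : BipartiteMultigraph P L E)
    (s : E → R) (φ : R →+* S) : (G.slopeMatrix s).map φ = G.slopeMatrix (fun e => φ (s e)) := by
  ext e k
  rcases k with ⟨u, i⟩ | v
  · fin_cases i <;> simp [slopeMatrix, apply_ite φ]
  · simp [slopeMatrix, apply_ite φ]

/-- The coefficients `l` on `I` form a row dependency of `G.slopeMatrix s`. -/
structure IsStress (G : BipartiteMultigraph P L E) (s : E → ℝ) (I : Finset E) (l : E → ℝ) :
    Prop where
  pt_sum : ∀ u, ∑ e ∈ I with G.pt e = u, l e = 0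
  pt_slope_sum : ∀ u, ∑ e ∈ I with G.pt e = u, l e * s e = 0
  ln_sum : ∀ v, ∑ e ∈ I with G.ln e = v, l e = 0

variable {G : BipartiteMultigraph P L E} {s : E → ℝ} {I : Finset E} {l : E → ℝ}

theorem sum_mul_slopeMatrix_pt_zero (u : P) :
    ∑ e ∈ I, l e * G.slopeMatrix s e (Sum.inl (u, 0)) = ∑ e ∈ I with G.pt e = u, l e := by
  simp [slopeMatrix, Finset.sum_filter, eq_comm]

theorem sum_mul_slopeMatrix_pt_one (u : P) :
    ∑ e ∈ I, l e * G.slopeMatrix s e (Sum.inl (u, 1)) = ∑ e ∈ I with G.pt e = u, l e * s e := by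
  simp [slopeMatrix, Finset.sum_filter, eq_comm]

theorem sum_mul_slopeMatrix_ln (v : L) :
    ∑ e ∈ I, l e * G.slopeMatrix s e (Sum.inr v) = -∑ e ∈ I with G.ln e = v, l e := by
  rw [Finset.sum_filter, ← Finset.sum_neg_distrib]
  refine Finset.sum_congr rfl fun e _ => ?_
  by_cases h : G.ln e = v
  · simp [slopeMatrix, h]
  · simp [slopeMatrix, h, Ne.symm h]

theorem isStress_iff : G.IsStress s I l ↔ ∀ k, ∑ e ∈ I, l e * G.slopeMatrix s e k = 0 := by
  constructor
  · rintro ⟨h0, h1, h2⟩ (⟨u, i⟩ | v)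
    · fin_cases i
      · exact (sum_mul_slopeMatrix_pt_zero u).trans (h0 u)
      · exact (sum_mul_slopeMatrix_pt_one u).trans (h1 u)
    · rw [sum_mul_slopeMatrix_ln, h2, neg_zero]
  · intro h
    exact ⟨fun u => (sum_mul_slopeMatrix_pt_zero (s := s) u).symm.trans (h _),
      fun u => (sum_mul_slopeMatrix_pt_one u).symm.trans (h _),
      fun v => neg_eq_zero.1 ((sum_mul_slopeMatrix_ln (s := s) v).symm.trans (h _))⟩

theorem linearIndepOn_slopeMatrix_iff :
    LinearIndepOn ℝ (G.slopeMatrix s).row (I : Set E) ↔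
      ∀ l, G.IsStress s I l → ∀ e ∈ I, l e = 0 := by
  rw [linearIndepOn_finset_iff]
  refine forall_congr' fun l => ?_
  rw [isStress_iff, funext_iff]
  simp [Finset.sum_apply]

/-! #### Independent sets are sparse -/

/-- The point fibres partition `I`, so the equation at `u₀` follows from the others and the total.
This recovers a dropped column. -/
theorem sum_filter_eq_zero_of_forall_ne {φ : E → ℝ} {u₀ : P} (hu₀ : u₀ ∈ I.image G.pt)
    (h : ∑ e ∈ I, φ e = 0) (hne : ∀ u, u ≠ u₀ → ∑ e ∈ I with G.pt e = u, φ e = 0) :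
    ∑ e ∈ I with G.pt e = u₀, φ e = 0 := by
  rw [← h, ← Finset.sum_fiberwise_of_maps_to (s := I)
    (fun e he => Finset.mem_image_of_mem G.pt he)]
  exact (Finset.sum_eq_single_of_mem u₀ hu₀ fun u _ hu => hne u hu).symm

/-- `t ∘ ln` is constant on line fibres. Taking `t = 1` gives the first column relation, and taking
the slopes gives the second. -/
theorem sum_mul_eq_zero_of_ln_sum (h : ∀ v, ∑ e ∈ I with G.ln e = v, l e = 0) (t : L → ℝ) :
    ∑ e ∈ I, l e * t (G.ln e) = 0 := by
  rw [← Finset.sum_fiberwise_of_maps_to (fun e he => Finset.mem_image_of_mem G.ln he)]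
  refine Finset.sum_eq_zero fun v _ => ?_
  rw [← mul_zero (t v), ← h v, Finset.mul_sum]
  refine Finset.sum_congr rfl fun e he => ?_
  rw [(Finset.mem_filter.1 he).2, mul_comm]

theorem sum_filter_eq_zero_of_notMem_image {V : Type*} [DecidableEq V] {g : E → V} {φ : E → ℝ}
    {w : V} (hw : w ∉ I.image g) : ∑ e ∈ I with g e = w, φ e = 0 := by
  rw [Finset.filter_eq_empty_iff.2, Finset.sum_empty]
  rintro e he rfl
  exact hw (Finset.mem_image_of_mem g he)

/-- The first column of one point is redundant, whatever the slopes are. -/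
theorem sparse_one_of_linearIndepOn (h : LinearIndepOn ℝ (G.slopeMatrix s).row (I : Set E)) :
    G.Sparse 1 I := by
  intro J hJn hJ
  have hJ' := linearIndepOn_slopeMatrix_iff.1 (h.mono (Finset.coe_subset.2 hJ))
  obtain ⟨u₀, hu₀⟩ := hJn.image G.pt
  have hcard := card_le_card_of_forall_sum_eq_zero (G.slopeMatrix s) J
    (((J.image G.pt ×ˢ Finset.univ).erase (u₀, 0)).disjSum (J.image G.ln)) (fun l hl => by
      have hln : ∀ v, ∑ e ∈ J with G.ln e = v, l e = 0 := fun v => by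
        by_cases hv : v ∈ J.image G.ln
        · exact neg_eq_zero.1 ((sum_mul_slopeMatrix_ln (s := s) v).symm.trans
            (hl _ (Finset.inr_mem_disjSum.2 hv)))
        · exact sum_filter_eq_zero_of_notMem_image hv
      refine hJ' l ⟨?_, ?_, hln⟩
      · have hne : ∀ u, u ≠ u₀ → ∑ e ∈ J with G.pt e = u, l e = 0 := fun u hu => by
          by_cases hv : u ∈ J.image G.pt
          · exact (sum_mul_slopeMatrix_pt_zero (s := s) u).symm.trans
              (hl _ (Finset.inl_mem_disjSum.2 (by simpa [hu] using hv)))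
          · exact sum_filter_eq_zero_of_notMem_image hv
        intro u
        rcases eq_or_ne u u₀ with rfl | hu
        · exact sum_filter_eq_zero_of_forall_ne hu₀
            (by simpa using sum_mul_eq_zero_of_ln_sum hln (fun _ => 1)) hne
        · exact hne u hu
      · intro u
        by_cases hv : u ∈ J.image G.pt
        · exact (sum_mul_slopeMatrix_pt_one (s := s) u).symm.trans
            (hl _ (Finset.inl_mem_disjSum.2 (by simpa using hv)))
        · exact sum_filter_eq_zero_of_notMem_image hv)
  rw [Finset.card_disjSum, Finset.card_erase_of_mem (by simpa using hu₀), Finset.card_product,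
    Finset.card_univ, Fintype.card_fin] at hcard
  have := Finset.card_pos.2 ⟨u₀, hu₀⟩
  omega

/-- Slopes read off the lines make both columns of one point redundant; genericity plays no role. -/
theorem sparse_two_of_linearIndepOn {t : L → ℝ}
    (h : LinearIndepOn ℝ (G.slopeMatrix (fun e => t (G.ln e))).row (I : Set E)) :
    G.Sparse 2 I := by
  intro J hJn hJ
  have hJ' := linearIndepOn_slopeMatrix_iff.1 (h.mono (Finset.coe_subset.2 hJ))
  obtain ⟨u₀, hu₀⟩ := hJn.image G.pt
  have hcard := card_le_card_of_forall_sum_eq_zero (G.slopeMatrix (fun e => t (G.ln e))) J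
    ((((J.image G.pt).erase u₀) ×ˢ Finset.univ).disjSum (J.image G.ln)) (fun l hl => by
      have hln : ∀ v, ∑ e ∈ J with G.ln e = v, l e = 0 := fun v => by
        by_cases hv : v ∈ J.image G.ln
        · exact neg_eq_zero.1 ((sum_mul_slopeMatrix_ln v).symm.trans
            (hl _ (Finset.inr_mem_disjSum.2 hv)))
        · exact sum_filter_eq_zero_of_notMem_image hv
      have hne : ∀ u, u ≠ u₀ → ∑ e ∈ J with G.pt e = u, l e = 0 := fun u hu => by
        by_cases hv : u ∈ J.image G.pt
        · exact (sum_mul_slopeMatrix_pt_zero u).symm.trans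
            (hl _ (Finset.inl_mem_disjSum.2 (by simpa [hu] using hv)))
        · exact sum_filter_eq_zero_of_notMem_image hv
      have hne' : ∀ u, u ≠ u₀ → ∑ e ∈ J with G.pt e = u, l e * t (G.ln e) = 0 := fun u hu => by
        by_cases hv : u ∈ J.image G.pt
        · exact (sum_mul_slopeMatrix_pt_one u).symm.trans
            (hl _ (Finset.inl_mem_disjSum.2 (by simpa [hu] using hv)))
        · exact sum_filter_eq_zero_of_notMem_image hv
      refine hJ' l ⟨fun u => ?_, fun u => ?_, hln⟩
      · rcases eq_or_ne u u₀ with rfl | hu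
        · exact sum_filter_eq_zero_of_forall_ne hu₀
            (by simpa using sum_mul_eq_zero_of_ln_sum hln (fun _ => 1)) hne
        · exact hne u hu
      · rcases eq_or_ne u u₀ with rfl | hu
        · exact sum_filter_eq_zero_of_forall_ne hu₀ (sum_mul_eq_zero_of_ln_sum hln t) hne'
        · exact hne' u hu)
  rw [Finset.card_disjSum, Finset.card_product, Finset.card_erase_of_mem hu₀,
    Finset.card_univ, Fintype.card_fin] at hcard
  have := Finset.card_pos.2 ⟨u₀, hu₀⟩
  omega

/-! #### Sparse sets are independent for generic slopes -/

theorem IsStress.mono {I' : Finset E} (h : G.IsStress s I l) (hI' : I' ⊆ I)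
    (h0 : ∀ e ∈ I, e ∉ I' → l e = 0) : G.IsStress s I' l := by
  rw [isStress_iff] at h ⊢
  intro k
  rw [← h k]
  refine Finset.sum_subset hI' fun e he he' => ?_
  rw [h0 e he he', zero_mul]

theorem linearIndepOn_of_stress_eq_zero_off {I' : Finset E} (hI' : I' ⊆ I)
    (h : LinearIndepOn ℝ (G.slopeMatrix s).row (I' : Set E))
    (h0 : ∀ l, G.IsStress s I l → ∀ e ∈ I, e ∉ I' → l e = 0) :
    LinearIndepOn ℝ (G.slopeMatrix s).row (I : Set E) := by
  rw [linearIndepOn_slopeMatrix_iff] at h ⊢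
  intro l hl e he
  by_cases he' : e ∈ I'
  · exact h l (hl.mono hI' (h0 l hl)) e he'
  · exact h0 l hl e he he'

/-! ### Reductions at vertices of small degree -/

/-- A point-vertex of degree at most two can be deleted if its edges have distinct slopes. -/
theorem linearIndepOn_of_pt_card_le_two {u : P}
    (hcard : (I.filter (fun x => G.pt x = u)).card ≤ 2)
    (hs : ∀ e ∈ I, ∀ f ∈ I, e ≠ f → G.pt e = u → G.pt f = u → s e ≠ s f)
    (h : LinearIndepOn ℝ (G.slopeMatrix s).row (I.filter (fun x => G.pt x ≠ u) : Finset E)) :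
    LinearIndepOn ℝ (G.slopeMatrix s).row (I : Set E) := by
  refine linearIndepOn_of_stress_eq_zero_off (Finset.filter_subset _ _) h fun l hl e he he' => ?_
  have hu : G.pt e = u := by simpa [he] using he'
  have heF : e ∈ I.filter (fun x => G.pt x = u) := Finset.mem_filter.2 ⟨he, hu⟩
  have h1 := hl.pt_sum u
  have h2 := hl.pt_slope_sum u
  rw [← Finset.add_sum_erase _ _ heF] at h1 h2
  have hc : ((I.filter (fun x => G.pt x = u)).erase e).card ≤ 1 := by
    rw [Finset.card_erase_of_mem heF]
    omega
  rcases Nat.le_one_iff_eq_zero_or_eq_one.1 hc with h0 | h0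
  · rw [Finset.card_eq_zero.1 h0, Finset.sum_empty, add_zero] at h1
    exact h1
  · obtain ⟨f, hf⟩ := Finset.card_eq_one.1 h0
    rw [hf, Finset.sum_singleton] at h1 h2
    have hfm : f ∈ (I.filter (fun x => G.pt x = u)).erase e := hf ▸ Finset.mem_singleton_self f
    rw [Finset.mem_erase, Finset.mem_filter] at hfm
    have hsf := hs e he f hfm.2.1 hfm.1.symm hu hfm.2.2
    have : l e * (s e - s f) = 0 := by linear_combination h2 - s f * h1
    exact (mul_eq_zero.1 this).resolve_right (sub_ne_zero.2 hsf)

/-- An edge that is alone at its line-vertex can be deleted. -/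
theorem linearIndepOn_of_ln_unique {e : E} (he : e ∈ I)
    (huniq : ∀ x ∈ I, G.ln x = G.ln e → x = e)
    (h : LinearIndepOn ℝ (G.slopeMatrix s).row (I.erase e : Finset E)) :
    LinearIndepOn ℝ (G.slopeMatrix s).row (I : Set E) := by
  refine linearIndepOn_of_stress_eq_zero_off (Finset.erase_subset _ _) h fun l hl x hx hx' => ?_
  have hxe : x = e := by simpa [hx] using hx'
  subst hxe
  rw [← hl.ln_sum (G.ln x), Finset.sum_filter, Finset.sum_eq_single_of_mem x hx]
  · simp
  · intro y hy hyx
    rw [if_neg fun h => hyx (huniq y hy h)]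

/-- If `e`, `f` are the two edges at a line-vertex and `g` is an edge at `pt e` of the same slope
as `e`, then `e` can be deleted after moving the line-end of `f` to that of `g`. -/
theorem linearIndepOn_of_moveLine {s' : E → ℝ} {e f g : E} (he : e ∈ I) (hf : f ∈ I) (hg : g ∈ I)
    (hef : e ≠ f) (hge : g ≠ e) (hgf : g ≠ f) (hl : G.ln f = G.ln e)
    (hline : ∀ x ∈ I, G.ln x = G.ln e → x = e ∨ x = f) (hp : G.pt g = G.pt e)
    (hseg : s e = s g) (hs : ∀ x ∈ I.erase e, s x = s' x)
    (h : LinearIndepOn ℝ ((G.moveLine f (G.ln g)).slopeMatrix s').row (I.erase e : Finset E)) :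
    LinearIndepOn ℝ (G.slopeMatrix s).row (I : Set E) := by
  rw [linearIndepOn_slopeMatrix_iff] at h ⊢
  intro l hstr
  have hgI : g ∈ I.erase e := Finset.mem_erase.2 ⟨hge, hg⟩
  have hfI : f ∈ I.erase e := Finset.mem_erase.2 ⟨hef.symm, hf⟩
  -- Replacing `e` by `g` changes a weighted sum by `l e * (φ g - φ e)`. This vanishes in both
  -- equations at a point, as `g` and `e` share point and slope.
  have hsum : ∀ φ : E → ℝ, ∑ x ∈ I.erase e, (l x + if x = g then l e else 0) * φ x =
      ∑ x ∈ I, l x * φ x + l e * (φ g - φ e) := by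
    intro φ
    rw [← Finset.add_sum_erase _ _ he]
    simp only [add_mul, Finset.sum_add_distrib, ite_mul, zero_mul, Finset.sum_ite_eq', if_pos hgI]
    ring
  have hlef : l e + l f = 0 := by
    rw [← hstr.ln_sum (G.ln e), ← Finset.sum_pair hef]
    refine Finset.sum_congr ?_ fun _ _ => rfl
    ext x
    simp only [Finset.mem_insert, Finset.mem_singleton, Finset.mem_filter]
    constructor
    · rintro (rfl | rfl)
      exacts [⟨he, rfl⟩, ⟨hf, hl⟩]
    · exact fun hx => hline x hx.1 hx.2
  have hstr' : (G.moveLine f (G.ln g)).IsStress s' (I.erase e)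
      (fun x => l x + if x = g then l e else 0) := by
    refine ⟨fun u => ?_, fun u => ?_, fun v => ?_⟩
    · have h1 := hsum (fun x => if G.pt x = u then 1 else 0)
      have h2 := hstr.pt_sum u
      simp only [Finset.sum_filter, mul_ite, mul_one, mul_zero, hp] at h1 h2 ⊢
      rw [h2] at h1
      exact h1.trans (by simp)
    · have h1 := hsum (fun x => if G.pt x = u then s x else 0)
      have h2 := hstr.pt_slope_sum u
      simp only [Finset.sum_filter, mul_ite, mul_zero, hp, hseg, sub_self, add_zero] at h1 h2 ⊢
      rw [h2] at h1
      refine Eq.trans ?_ h1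
      refine Finset.sum_congr rfl fun x hx => ?_
      rw [hs x hx]
      rfl
    -- At `ln g` the extra `l e` on `g` cancels the coefficient `l f = -l e` of the moved edge.
    · have h1 := hsum (fun x => if G.ln x = v then 1 else 0)
      have h2 := hstr.ln_sum v
      rw [Finset.sum_filter] at h2
      simp only [mul_ite, mul_one, mul_zero] at h1
      rw [h2, ← Finset.add_sum_erase _ _ hfI] at h1
      rw [Finset.sum_filter, ← Finset.add_sum_erase _ _ hfI]
      have h3 : ∀ x ∈ (I.erase e).erase f, (G.moveLine f (G.ln g)).ln x = G.ln x := fun x hx =>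
        Function.update_of_ne (Finset.mem_erase.1 hx).1 _ _
      have h4 : (G.moveLine f (G.ln g)).ln f = G.ln g := Function.update_self ..
      rw [Finset.sum_congr rfl fun x hx => by rw [h3 x hx], h4]
      rw [if_neg hgf.symm] at h1 ⊢
      rw [hl] at h1
      split_ifs at h1 ⊢ <;> linarith
  have hl' := h _ hstr'
  have hlf : l f = 0 := by simpa [hgf.symm] using hl' f hfI
  have hle : l e = 0 := by rwa [hlf, add_zero] at hlef
  intro x hx
  rcases eq_or_ne x e with rfl | hxe
  · exact hle
  · simpa [hle] using hl' x (Finset.mem_erase.2 ⟨hxe, hx⟩)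

/-! ### Induction on the number of edges -/

/-- Sparse sets of rows are independent for slopes that are generic in the sense that slopes at a
point-vertex are distinct and that the specializations needed for `linearIndepOn_of_moveLine`
exist. -/
theorem linearIndepOn_of_sparse [Fintype P] [Fintype L] [Finite E] {σ : Type*} {k : ℕ}
    (hk1 : 1 ≤ k) (hk2 : k ≤ 2)
    (q : (E → L) → E → MvPolynomial σ ℚ) {x : σ → ℝ} (hx : AlgebraicIndependent ℚ x)
    (hdist : ∀ (G : BipartiteMultigraph P L E) (I : Finset E), G.Sparse k I →
      ∀ e ∈ I, ∀ f ∈ I, e ≠ f → G.pt e = G.pt f →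
        MvPolynomial.aeval x (q G.ln e) ≠ MvPolynomial.aeval x (q G.ln f))
    (hspec : ∀ (ln : E → L) (I : Finset E) (e f g : E), g ∈ I → g ≠ e → g ≠ f → ln f = ln e →
      (∀ z ∈ I, ln z = ln e → z = e ∨ z = f) →
      ∃ y : σ → ℝ, MvPolynomial.aeval y (q ln e) = MvPolynomial.aeval y (q ln g) ∧
        ∀ z ∈ I.erase e, MvPolynomial.aeval y (q ln z) =
          MvPolynomial.aeval x (q (Function.update ln f (ln g)) z)) :
    ∀ (n : ℕ) (G : BipartiteMultigraph P L E) (I : Finset E), I.card = n → G.Sparse k I →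
      LinearIndepOn ℝ (G.slopeMatrix fun e => MvPolynomial.aeval x (q G.ln e)).row (I : Set E) := by
  -- The graph varies in the induction because line-ends move; `q` takes `ln` as an argument so that
  -- slopes can follow them.
  intro n
  induction n using Nat.strong_induction_on with
  | _ n ih =>
    intro G I hn hI
    rcases I.eq_empty_or_nonempty with rfl | hIn
    · simp
    by_cases hdeg : ∀ u ∈ I.image G.pt, 3 ≤ (I.filter (fun x => G.pt x = u)).card
    · obtain ⟨v, hv, hcard⟩ := hI.exists_line_card_le_two hk1 hIn hdeg
      obtain ⟨e, he, rfl⟩ := Finset.mem_image.1 hv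
      have hlt : (I.erase e).card < n := hn ▸ Finset.card_erase_lt_of_mem he
      have heF : e ∈ I.filter (fun x => G.ln x = G.ln e) := Finset.mem_filter.2 ⟨he, rfl⟩
      by_cases huniq : ∀ x ∈ I, G.ln x = G.ln e → x = e
      · exact linearIndepOn_of_ln_unique he huniq
          (ih _ hlt G _ rfl (hI.mono (Finset.erase_subset _ _)))
      · push Not at huniq
        obtain ⟨f, hf, hl, hfe⟩ := huniq
        have hline : ∀ x ∈ I, G.ln x = G.ln e → x = e ∨ x = f := by
          intro x hx hxl
          by_contra! hcon
          have : ({x, e, f} : Finset E) ⊆ I.filter (fun x => G.ln x = G.ln e) := by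
            simp [Finset.insert_subset_iff, hx, hxl, he, hf, hl]
          have := Finset.card_le_card this
          rw [Finset.card_eq_three.2 ⟨x, e, f, hcon.1, hcon.2, hfe.symm, rfl⟩] at this
          omega
        obtain ⟨g, hg, hge, hgf, hp, hsp⟩ := hI.exists_moveLine hk2 he hf hfe.symm hl
          (hdeg _ (Finset.mem_image_of_mem _ he))
        obtain ⟨y, hy1, hy2⟩ := hspec G.ln I e f g hg hge hgf hl hline
        have hind := linearIndepOn_of_moveLine he hf hg hfe.symm hge hgf hl hline hp hy1 hy2
          (ih _ hlt _ _ rfl hsp)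
        have hmap : ∀ z : σ → ℝ, (G.slopeMatrix (q G.ln)).map (MvPolynomial.aeval z) =
            G.slopeMatrix fun e => MvPolynomial.aeval z (q G.ln e) := fun z =>
          slopeMatrix_map G (q G.ln) (MvPolynomial.aeval z : MvPolynomial σ ℚ →ₐ[ℚ] ℝ).toRingHom
        rw [← hmap] at hind ⊢
        exact linearIndepOn_row_of_algebraicIndependent _ hx y hind
    · push Not at hdeg
      obtain ⟨u, hu, hcard⟩ := hdeg
      have hlt : (I.filter (fun x => G.pt x ≠ u)).card < n := by
        obtain ⟨e, he, rfl⟩ := Finset.mem_image.1 hu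
        rw [← hn]
        exact Finset.card_lt_card (Finset.filter_ssubset.2 ⟨e, he, by simp⟩)
      refine linearIndepOn_of_pt_card_le_two (by omega) ?_
        (ih _ hlt G _ rfl (hI.mono (Finset.filter_subset _ _)))
      exact fun e he f hf hef hpe hpf => hdist G I hI e he f hf hef (hpe.trans hpf.symm)

theorem linearIndepOn_slopeMatrix_iff_sparse_one [Fintype P] [Fintype L] [Finite E] {c : E → ℝ}
    (hc : AlgebraicIndependent ℚ c) :
    LinearIndepOn ℝ (G.slopeMatrix c).row (I : Set E) ↔ G.Sparse 1 I := by
  refine ⟨sparse_one_of_linearIndepOn, fun h => ?_⟩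
  have := linearIndepOn_of_sparse (P := P) (k := 1) le_rfl one_le_two
    (fun (_ : E → L) e => MvPolynomial.X e) hc ?_ ?_ _ G I rfl h
  · simpa using this
  · intro G I _ e _ f _ hef _
    simpa using hc.injective.ne hef
  · intro ln I e f g _ hge _ _ _
    -- Only the slope of the deleted edge `e` changes.
    refine ⟨Function.update c e (c g), by simp [hge], fun z hz => ?_⟩
    simp [(Finset.mem_erase.1 hz).1]

theorem linearIndepOn_slopeMatrix_iff_sparse_two [Fintype P] [Fintype L] [Finite E] {t : L → ℝ}
    (ht : AlgebraicIndependent ℚ t) :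
    LinearIndepOn ℝ (G.slopeMatrix fun e => t (G.ln e)).row (I : Set E) ↔ G.Sparse 2 I := by
  refine ⟨sparse_two_of_linearIndepOn, fun h => ?_⟩
  have := linearIndepOn_of_sparse (P := P) (k := 2) one_le_two le_rfl
    (fun (ln : E → L) e => MvPolynomial.X (ln e)) ht ?_ ?_ _ G I rfl h
  · simpa using this
  · intro G I hI e he f hf hef hp
    simpa using ht.injective.ne fun hl => hef (hI.eq_of_parallel he hf hp hl)
  · intro ln I e f g hg hge hgf hl hline
    have hlg : ln g ≠ ln e := fun hc => (hline g hg hc).elim hge hgf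
    -- The line of `e` carries only `e` and `f`. The slope of `f` becomes `t (ln g)`, exactly its
    -- slope after the move.
    refine ⟨Function.update t (ln e) (t (ln g)), by simp [hlg], fun z hz => ?_⟩
    rcases eq_or_ne z f with rfl | hzf
    · simp [hl]
    · have : ln z ≠ ln e := fun hc =>
        (hline z (Finset.mem_of_mem_erase hz) hc).elim (Finset.mem_erase.1 hz).1 hzf
      simp [hzf, this]

end BipartiteMultigraph

/-! ### The matrix `A(G,t,c)` and the main theorem -/

/-- If the sums `x e + z e`, `e ∈ I`, are linearly independent, then `I` splits into a part on
which `x` and a part on which `z` is linearly independent. -/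
theorem LinearIndepOn.exists_split_add {E V : Type*} [AddCommGroup V] [Module ℝ V] {x z : E → V}
    {I : Set E} (hI : I.Finite) (h : LinearIndepOn ℝ (x + z) I) :
    ∃ S : Set E, LinearIndepOn ℝ x (I ∩ S) ∧ LinearIndepOn ℝ z (I \ S) := by
  classical
  have : Fintype I := hI.fintype
  obtain ⟨S, hS⟩ := LinearIndependent.exists_piecewise
    (x := fun i : I => x i) (z := fun i : I => z i) h
  set S' : Set E := Subtype.val '' (S : Set I)
  have hS' : LinearIndepOn ℝ (S'.piecewise x z) I := by
    have : (fun i : I => S'.piecewise x z i) =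
        S.piecewise (fun i : I => x i) (fun i : I => z i) := by
      ext i
      simp [Set.piecewise, Finset.piecewise, S']
    have hli : LinearIndependent ℝ (fun i : I => S'.piecewise x z i) := by
      rw [this]
      exact hS
    exact hli
  refine ⟨S', (hS'.mono Set.inter_subset_left).congr fun e he => ?_,
    (hS'.mono Set.sdiff_subset).congr fun e he => ?_⟩
  · exact Set.piecewise_eq_of_mem _ _ _ he.2
  · exact Set.piecewise_eq_of_notMem _ _ _ he.2

namespace BipartiteMultigraph

variable {P L E : Type*} [DecidableEq P] [DecidableEq L] [DecidableEq E]

/-- The matrix `A(G,t,c)` with indeterminate parameters. -/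
noncomputable def polynomialMatrixA (G : BipartiteMultigraph P L E) :
    Matrix E ((P ⊕ L) × Fin 2) (MvPolynomial (L ⊕ E) ℚ) :=
  Matrix.of fun e k =>
    match k with
    | (Sum.inl u, i) => if u = G.pt e then ![1, MvPolynomial.X (Sum.inl (G.ln e))] i else 0
    | (Sum.inr v, i) => if v = G.ln e then ![MvPolynomial.X (Sum.inr e), -1] i else 0

theorem polynomialMatrixA_map (G : BipartiteMultigraph P L E) (t : L → ℝ) (c : E → ℝ) :
    G.polynomialMatrixA.map (MvPolynomial.aeval (Sum.elim t c)) = G.matrixA t c := by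
  ext e ⟨u | v, i⟩
  · fin_cases i <;> by_cases h : u = G.pt e <;> simp [polynomialMatrixA, matrixA, h]
  · fin_cases i <;> by_cases h : v = G.ln e <;> simp [polynomialMatrixA, matrixA, h]

/-- The columns of `A(G,t,c)` that carry `C(G,t)`. -/
def columnsC : (P × Fin 2) ⊕ L → (P ⊕ L) × Fin 2 :=
  Sum.elim (fun k => (Sum.inl k.1, k.2)) (fun v => (Sum.inr v, 1))

theorem matrixA_columnsC (G : BipartiteMultigraph P L E) (t : L → ℝ) (c : E → ℝ) (e : E)
    (k : (P × Fin 2) ⊕ L) : G.matrixA t c e (columnsC k) = G.matrixC t e k := by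
  rcases k with ⟨u, i⟩ | v <;> rfl

/-- The first column of `ln e`, for `e ∈ J₂`, has its only nonzero entry in row `e`. This kills the
coefficients on `J₂`; the columns of `C` then handle `J₁`. -/
theorem linearIndepOn_matrixA_indicator {G : BipartiteMultigraph P L E} {t : L → ℝ}
    {J₁ J₂ : Finset E} (hd : Disjoint J₁ J₂)
    (h₁ : LinearIndepOn ℝ (G.matrixC t).row (J₁ : Set E)) (h₂ : Set.InjOn G.ln J₂) :
    LinearIndepOn ℝ (G.matrixA t (fun e => if e ∈ J₂ then 1 else 0)).row
      ((J₁ ∪ J₂ : Finset E) : Set E) := by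
  rw [linearIndepOn_finset_iff] at h₁ ⊢
  intro l hl
  have hl2 : ∀ e ∈ J₂, l e = 0 := by
    intro e he
    have := congrFun hl (Sum.inr (G.ln e), 0)
    rw [Finset.sum_apply, Finset.sum_eq_single_of_mem e (Finset.mem_union_right _ he)] at this
    · simpa [matrixA, he] using this
    · intro f _ hfe
      by_cases hf : f ∈ J₂
      · have : G.ln e ≠ G.ln f := fun hc => hfe (h₂ hf he hc.symm)
        simp [matrixA, this]
      · simp [matrixA, hf]
  intro e he
  rcases Finset.mem_union.1 he with he | he
  · refine h₁ l ?_ e he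
    ext k
    have := congrFun hl (columnsC k)
    rw [Finset.sum_union hd, Finset.sum_eq_zero (s := J₂) fun f hf => by rw [hl2 f hf, zero_smul],
      add_zero, Finset.sum_apply] at this
    rw [Finset.sum_apply]
    simpa [matrixA_columnsC] using this
  · exact hl2 e he

theorem exists_split_of_linearIndepOn_matrixA {G : BipartiteMultigraph P L E} {t : L → ℝ}
    {c : E → ℝ} {I : Set E} (hI : I.Finite) (h : LinearIndepOn ℝ (G.matrixA t c).row I) :
    ∃ S : Set E, LinearIndepOn ℝ (G.matrixC t).row (I ∩ S) ∧ Set.InjOn G.ln (I \ S) := by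
  let x : E → (P ⊕ L) × Fin 2 → ℝ := fun e k =>
    match k with
    -- `x` is the row of `C` padded by zeros, and `z` is the single entry `c e`.
    | (Sum.inl u, i) => G.matrixC t e (Sum.inl (u, i))
    | (Sum.inr v, i) => ![0, G.matrixC t e (Sum.inr v)] i
  let z : E → (P ⊕ L) × Fin 2 → ℝ := fun e => c e • Pi.single (Sum.inr (G.ln e), 0) 1
  have hxz : (G.matrixA t c).row = x + z := by
    funext e ⟨w, i⟩
    rcases w with u | v
    · simp [x, z, matrixA, matrixC]
    · fin_cases i
      · by_cases hv : v = G.ln e <;> simp [x, z, matrixA, matrixC, hv]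
      · simp [x, z, matrixA, matrixC]
  rw [hxz] at h
  obtain ⟨S, hx, hz⟩ := h.exists_split_add hI
  refine ⟨S, ?_, ?_⟩
  · rw [linearIndepOn_iff'] at hx ⊢
    intro T l hT hl
    refine hx T l hT ?_
    ext ⟨w, i⟩
    rcases w with u | v
    · simpa [x] using congrFun hl (Sum.inl (u, i))
    · fin_cases i
      · simp [x]
      · simpa [x] using congrFun hl (Sum.inr v)
  · intro e he f hf hef
    by_contra hne
    -- Two edges at one line would give proportional vectors `z`.
    have hze : c e ≠ 0 := fun h0 => hz.ne_zero he (by simp [z, h0])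
    have hp := (hz.mono (t := {e, f}) (Set.insert_subset he (Set.singleton_subset_iff.2 hf)))
    rw [LinearIndepOn.pair_iff z hne] at hp
    have := hp (c f) (-c e) (by simp only [z, hef, smul_smul]; module)
    exact hze (neg_eq_zero.1 this.2)

theorem linearIndepOn_matrixA_iff [Fintype P] [Fintype L] [Finite E]
    {G : BipartiteMultigraph P L E} {t : L → ℝ} {c : E → ℝ} (hgen : G.IsGenericFrame t c)
    {I : Set E} : LinearIndepOn ℝ (G.matrixA t c).row I ↔
      ∃ I₁ I₂ : Set E, LinearIndepOn ℝ (G.matrixC t).row I₁ ∧ Set.InjOn G.ln I₂ ∧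
        I = I₁ ∪ I₂ := by
  classical
  constructor
  · intro h
    obtain ⟨S, h₁, h₂⟩ := exists_split_of_linearIndepOn_matrixA (Set.toFinite I) h
    exact ⟨_, _, h₁, h₂, (Set.inter_union_sdiff I S).symm⟩
  · rintro ⟨I₁, I₂, h₁, h₂, rfl⟩
    obtain ⟨J₁, rfl⟩ := (Set.toFinite I₁).exists_finset_coe
    obtain ⟨J₂, rfl⟩ := (Set.toFinite I₂).exists_finset_coe
    -- Only `c` is specialized; `t` keeps its generic value.
    have h := linearIndepOn_matrixA_indicator (J₂ := J₂ \ J₁) Finset.disjoint_sdiff h₁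
      (h₂.mono (Finset.coe_subset.2 Finset.sdiff_subset))
    rw [Finset.union_sdiff_self_eq_union, Finset.coe_union, ← polynomialMatrixA_map] at h
    rw [← polynomialMatrixA_map]
    exact linearIndepOn_row_of_algebraicIndependent _ hgen _ h

/-! ### Row matroids as induced matroids -/

theorem inducedMatroid_nuL_indep_iff [Finite E] (G : BipartiteMultigraph P L E) (I : Finset E) :
    (inducedMatroid (fun S => G.nuL S) G.isMatroidInducing_nuL).Indep (I : Set E) ↔
      Set.InjOn G.ln I := by
  rw [inducedMatroid_indep_iff]
  constructor
  · intro h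
    rcases I.eq_empty_or_nonempty with rfl | hI
    · simp
    · have := h I hI subset_rfl
      rw [nuL, Nat.cast_le] at this
      exact Finset.card_image_iff.1 (le_antisymm Finset.card_image_le this)
  · intro h J _ hJ
    rw [nuL, Finset.card_image_of_injOn (h.mono (Finset.coe_subset.2 hJ))]

theorem rowMatroid_matrixB [Fintype P] [Fintype L] [Finite E] (G : BipartiteMultigraph P L E)
    {c : E → ℝ} (hc : AlgebraicIndependent ℚ c) :
    rowMatroid (G.matrixB c) = inducedMatroid (fun S => 2 * G.nuP S + G.nuL S - 1)
      G.isMatroidInducing_two_nuP_add_nuL_sub_one := by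
  refine Matroid.ext_indep rfl fun I _ => ?_
  obtain ⟨I, rfl⟩ := (Set.toFinite I).exists_finset_coe
  rw [rowMatroid_indep_iff, inducedMatroid_indep_iff]
  -- `matrixB` is by definition `slopeMatrix` with slopes `c`.
  refine (linearIndepOn_slopeMatrix_iff_sparse_one hc).trans ?_
  refine forall_congr' fun J => imp_congr_right fun _ => imp_congr_right fun _ => ?_
  simp only [nuP, nuL]
  omega

theorem rowMatroid_matrixC [Fintype P] [Fintype L] [Finite E] (G : BipartiteMultigraph P L E)
    {t : L → ℝ} (ht : AlgebraicIndependent ℚ t) :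
    rowMatroid (G.matrixC t) = inducedMatroid (fun S => 2 * G.nuP S + G.nuL S - 2)
      G.isMatroidInducing_two_nuP_add_nuL_sub_two := by
  refine Matroid.ext_indep rfl fun I _ => ?_
  obtain ⟨I, rfl⟩ := (Set.toFinite I).exists_finset_coe
  rw [rowMatroid_indep_iff, inducedMatroid_indep_iff]
  refine (linearIndepOn_slopeMatrix_iff_sparse_two ht).trans ?_
  refine forall_congr' fun J => imp_congr_right fun _ => imp_congr_right fun _ => ?_
  simp only [nuP, nuL]
  omega

end BipartiteMultigraph

theorem mainTheorem4 {P L E : Type*} [Fintype P] [DecidableEq P] [Fintype L] [DecidableEq L]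
    [Fintype E] [DecidableEq E] (G : BipartiteMultigraph P L E) (t : L → ℝ) (c : E → ℝ)
    (hgen : G.IsGenericFrame t c) :
    rowMatroid (G.matrixB c) =
        inducedMatroid (fun S => 2 * G.nuP S + G.nuL S - 1)
          G.isMatroidInducing_two_nuP_add_nuL_sub_one ∧
      rowMatroid (G.matrixC t) =
        inducedMatroid (fun S => 2 * G.nuP S + G.nuL S - 2)
          G.isMatroidInducing_two_nuP_add_nuL_sub_two ∧
      rowMatroid (G.matrixA t c) =
        matroidUnion
          (inducedMatroid (fun S => 2 * G.nuP S + G.nuL S - 2)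
            G.isMatroidInducing_two_nuP_add_nuL_sub_two)
          (inducedMatroid (fun S => G.nuL S) G.isMatroidInducing_nuL) := by
  have hc : AlgebraicIndependent ℚ c := by
    simpa using AlgebraicIndependent.comp hgen Sum.inr Sum.inr_injective
  have ht : AlgebraicIndependent ℚ t := by
    simpa using AlgebraicIndependent.comp hgen Sum.inl Sum.inl_injective
  refine ⟨G.rowMatroid_matrixB hc, G.rowMatroid_matrixC ht, ?_⟩
  refine Matroid.ext_indep ?_ fun I _ => ?_
  · exact (Set.union_self _).symm
  · rw [rowMatroid_indep_iff, matroidUnion_indep_iff,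
      BipartiteMultigraph.linearIndepOn_matrixA_iff hgen]
    refine exists_congr fun I₁ => exists_congr fun I₂ => ?_
    obtain ⟨J₂, rfl⟩ := (Set.toFinite I₂).exists_finset_coe
    rw [← G.rowMatroid_matrixC ht, rowMatroid_indep_iff,
      BipartiteMultigraph.inducedMatroid_nuL_indep_iff]
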